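/- For an entire function $w$ let $T(r,w)$ be its Nevanlinna characteristic, and for each integer $i\ge 1$ put $$\sigma_i(w)=\limsup_{r\to\infty}\frac{\log_i T(r,w)}{\log r}\in[-\infty,\infty],$$ where $\log_i$ is the $i$-fold iterated logarithm; thus $\sigma_1(w)$ is the order of $w$. An entire function $w$ of infinite order (that is, with $\sigma_1(w)=\infty$) is said to have finite iterated order if $\sigma_i(w)<\infty$ for some integer $i\ge 2$. **Theorem 1.4.** Let $a(z)$ and $a_0(z)$ be rational functions with complex coefficients, with $a(z)\not\equiv 0$. Then the equation $$w(z+1)-w(z-1)+a(z)\frac{w'(z)}{w(z)}=a_0(z)$$ (understood as an identity between meromorphic functions, with $w\not\equiv 0$) has no entire solution $w$ of infinite order and finite iterated order. -/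

import Mathlib

namespace DelayDifferential

/-- The value of a rational function at a complex point; meaningful where the (reduced)
denominator does not vanish, that is, off the poles of the rational function. -/
noncomputable def ratValue (R : RatFunc ℂ) (z : ℂ) : ℂ :=
  RatFunc.eval (RingHom.id ℂ) z R

/-- The poles of a rational function: the zeros of the denominator of its reduced form. -/
def IsPole (R : RatFunc ℂ) (z : ℂ) : Prop :=
  R.denom.eval z = 0

/-- `w` is an entire solution of
`w(z + 1) - w(z - 1) + a(z) w'(z) / w(z) = a₀(z)`:
it is entire, not identically zero, and the identity of meromorphic functions holds,
that is, it holds at every `z` that is neither a zero of `w` nor a pole of `a` or `a₀`. -/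
structure IsEntireSolution (a a₀ : RatFunc ℂ) (w : ℂ → ℂ) : Prop where
  entire : Differentiable ℂ w
  ne_zero : ∃ z, w z ≠ 0
  equation : ∀ z, w z ≠ 0 → ¬ IsPole a z → ¬ IsPole a₀ z →
    w (z + 1) - w (z - 1) + ratValue a z * (deriv w z / w z) = ratValue a₀ z

/-- The iterated `i`-order `σ_i(w) = limsup_{r → ∞} log_i T(r, w) / log r`, an extended real
number. Here `log_i` is the `i`-fold iterate of the logarithm and `T(r, w)` is the Nevanlinna
characteristic of `w` (with respect to the value `∞`). For `i = 1` this is the order of `w`, and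
for `i = 2` the hyper-order. -/
noncomputable def iteratedOrder (i : ℕ) (w : ℂ → ℂ) : EReal :=
  Filter.limsup
    (fun r : ℝ =>
      ((Real.log^[i] (ValueDistribution.characteristic w ⊤ r) / Real.log r : ℝ) : EReal))
    Filter.atTop

/-- `w` is of infinite order: `σ_1(w) = ∞`. -/
def HasInfiniteOrder (w : ℂ → ℂ) : Prop :=
  iteratedOrder 1 w = ⊤

/-- `w` is of finite iterated order: `σ_i(w) < ∞` for some `i ≥ 2`. -/
def HasFiniteIteratedOrder (w : ℂ → ℂ) : Prop :=
  ∃ i : ℕ, 2 ≤ i ∧ iteratedOrder i w < ⊤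

end DelayDifferential

/-! Clearing denominators gives `A w (w(z+1) - w(z-1)) + B w' = C w` with polynomial coefficients.
With the shifts of `w` regarded as given, this is a linear first-order equation for `w`, regular
where `B ≠ 0`; by uniqueness every zero of `w` is a root of `B`, so `w = P e^g`.

Dividing by `e^g` leaves `U e^{g(z+1)} - V e^{g(z-1)} = k`, where `k` involves only polynomials and
`g'`. Together with its derivative this is a linear system for the two exponentials, so
(`exists_tame_or_deriv_eq`) either one of them is a quotient of functions bounded by powers of `|z|`
and of `M(r) = maxMod g r`, or `g'` is rational. In the latter case `g` grows polynomially and `w`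
has finite order.

In the former case the characteristic of a shift of `e^g` is `O(log r + log M(r + s))` up to
constants, while Poisson's formula and Borel–Carathéodory bound `M(r)` by `r ^ 2` times that
characteristic (`exists_maxMod_recursion`). Hence `√M` at least exponentiates over each step of
fixed length `s` once `M(R) ≥ R ^ 6`, and infinite order supplies such `R`. After `n` steps `M`
exceeds a tower of `n` exponentials, which finite iterated order forbids
(`false_of_exp_iterate_le`). -/

namespace DelayDifferential

open Real Metric ValueDistribution Filter Polynomial

/-! ### Maximum modulus and tame functions -/

/-- The maximum modulus of `g` on the closed disc of radius `r` around the origin. -/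
noncomputable def maxMod (g : ℂ → ℂ) (r : ℝ) : ℝ :=
  sSup ((fun z ↦ ‖g z‖) '' closedBall 0 r)

lemma bddAbove_norm_image {g : ℂ → ℂ} (hg : Continuous g) (r : ℝ) :
    BddAbove ((fun z ↦ ‖g z‖) '' closedBall 0 r) :=
  ((isCompact_closedBall 0 r).image hg.norm).bddAbove

lemma norm_le_maxMod {g : ℂ → ℂ} (hg : Continuous g) {z : ℂ} {r : ℝ} (hz : ‖z‖ ≤ r) :
    ‖g z‖ ≤ maxMod g r :=
  le_csSup (bddAbove_norm_image hg r) ⟨z, by simpa using hz, rfl⟩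

lemma maxMod_le {g : ℂ → ℂ} {r b : ℝ} (hr : 0 ≤ r) (h : ∀ z, ‖z‖ ≤ r → ‖g z‖ ≤ b) :
    maxMod g r ≤ b := by
  refine csSup_le ((nonempty_closedBall.2 hr).image _) ?_
  rintro _ ⟨z, hz, rfl⟩
  exact h z (by simpa using hz)

lemma maxMod_nonneg (g : ℂ → ℂ) (r : ℝ) : 0 ≤ maxMod g r := by
  refine Real.sSup_nonneg ?_
  rintro _ ⟨z, -, rfl⟩
  exact norm_nonneg _

lemma maxMod_mono {g : ℂ → ℂ} (hg : Continuous g) {r s : ℝ} (hr : 0 ≤ r) (hrs : r ≤ s) :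
    maxMod g r ≤ maxMod g s :=
  maxMod_le hr fun _ hz ↦ norm_le_maxMod hg (hz.trans hrs)

/-- The comparison function for growth relative to `g`, with a parameter `N` controlling shifts
of the radius and constants. -/
noncomputable def growthBase (g : ℂ → ℂ) (N : ℕ) (r : ℝ) : ℝ :=
  (N + 2 + r) * (1 + maxMod g (r + N))

lemma two_le_growthBase (g : ℂ → ℂ) (N : ℕ) {r : ℝ} (hr : 0 ≤ r) : 2 ≤ growthBase g N r := by
  have h1 := maxMod_nonneg g (r + N)
  have h2 : (0 : ℝ) ≤ N := N.cast_nonneg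
  unfold growthBase
  nlinarith [mul_nonneg h2 h1, mul_nonneg hr h1]

/-- Only `r + N` matters, so an increase of the radius can be paid for by an increase of `N`. This
makes tameness stable under shifts and derivatives. -/
lemma growthBase_mono {g : ℂ → ℂ} (hg : Continuous g) {N N' : ℕ} {r r' : ℝ} (hr : 0 ≤ r)
    (h : r + N ≤ r' + N') : growthBase g N r ≤ growthBase g N' r' := by
  have h1 := maxMod_nonneg g (r + N)
  have h2 : (0 : ℝ) ≤ N := N.cast_nonneg
  have h3 := maxMod_mono hg (by positivity) h
  unfold growthBase
  gcongr ?_ * (1 + ?_)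
  · linarith
  · linarith

/-- `f` is bounded by a power of the modulus times a power of the maximum modulus of `g`
(on a slightly larger disc). -/
def Tame (g f : ℂ → ℂ) : Prop :=
  ∃ N : ℕ, ∀ z, ‖f z‖ ≤ growthBase g N ‖z‖ ^ N

namespace Tame

variable {g f f₁ f₂ : ℂ → ℂ}

lemma of_le {N N' : ℕ} (hg : Continuous g) (h : N ≤ N')
    (hf : ∀ z, ‖f z‖ ≤ growthBase g N ‖z‖ ^ N) (z : ℂ) : ‖f z‖ ≤ growthBase g N' ‖z‖ ^ N := by
  refine (hf z).trans ?_
  have := two_le_growthBase g N (norm_nonneg z)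
  gcongr
  exact growthBase_mono hg (norm_nonneg z) (by gcongr)

lemma add (hg : Continuous g) (h₁ : Tame g f₁) (h₂ : Tame g f₂) :
    Tame g (fun z ↦ f₁ z + f₂ z) := by
  obtain ⟨N₁, h₁⟩ := h₁
  obtain ⟨N₂, h₂⟩ := h₂
  refine ⟨N₁ + N₂ + 1, fun z ↦ ?_⟩
  have h₁ := of_le hg (show N₁ ≤ N₁ + N₂ + 1 by omega) h₁ z
  have h₂ := of_le hg (show N₂ ≤ N₁ + N₂ + 1 by omega) h₂ z
  have hX := two_le_growthBase g (N₁ + N₂ + 1) (norm_nonneg z)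
  set X := growthBase g (N₁ + N₂ + 1) ‖z‖
  have e₁ : X ^ N₁ ≤ X ^ (N₁ + N₂) := pow_le_pow_right₀ (by linarith) (by omega)
  have e₂ : X ^ N₂ ≤ X ^ (N₁ + N₂) := pow_le_pow_right₀ (by linarith) (by omega)
  have e₃ : 0 ≤ X ^ (N₁ + N₂) := by positivity
  calc ‖f₁ z + f₂ z‖ ≤ ‖f₁ z‖ + ‖f₂ z‖ := norm_add_le _ _
    _ ≤ X ^ (N₁ + N₂) * 2 := by linarith
    _ ≤ X ^ (N₁ + N₂) * X := by gcongr
    _ = X ^ (N₁ + N₂ + 1) := (pow_succ _ _).symm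

lemma mul (hg : Continuous g) (h₁ : Tame g f₁) (h₂ : Tame g f₂) :
    Tame g (fun z ↦ f₁ z * f₂ z) := by
  obtain ⟨N₁, h₁⟩ := h₁
  obtain ⟨N₂, h₂⟩ := h₂
  refine ⟨N₁ + N₂, fun z ↦ ?_⟩
  have h₁ := of_le hg (show N₁ ≤ N₁ + N₂ by omega) h₁ z
  have h₂ := of_le hg (show N₂ ≤ N₁ + N₂ by omega) h₂ z
  have hX := two_le_growthBase g (N₁ + N₂) (norm_nonneg z)
  rw [norm_mul, pow_add]
  gcongr

lemma const (g : ℂ → ℂ) (c : ℂ) : Tame g (fun _ ↦ c) := by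
  obtain ⟨n, hn⟩ := exists_nat_ge ‖c‖
  refine ⟨n + 1, fun z ↦ ?_⟩
  have hX := two_le_growthBase g (n + 1) (norm_nonneg z)
  have h : (n : ℝ) ≤ growthBase g (n + 1) ‖z‖ := by
    have h1 := maxMod_nonneg g (‖z‖ + (n + 1 : ℕ))
    have h2 := norm_nonneg z
    have h3 : (0 : ℝ) ≤ n := n.cast_nonneg
    unfold growthBase
    push_cast at h1 ⊢
    nlinarith [mul_nonneg h2 h1, mul_nonneg h3 h1]
  exact (hn.trans h).trans (le_self_pow₀ (by linarith) (by omega))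

lemma id (g : ℂ → ℂ) : Tame g (fun z ↦ z) := by
  refine ⟨1, fun z ↦ ?_⟩
  have h1 := maxMod_nonneg g (‖z‖ + (1 : ℕ))
  have h2 := norm_nonneg z
  rw [pow_one]
  unfold growthBase
  push_cast at h1 ⊢
  nlinarith [mul_nonneg h2 h1]

lemma self (hg : Continuous g) : Tame g g := by
  refine ⟨1, fun z ↦ ?_⟩
  have h0 : ‖g z‖ ≤ maxMod g (‖z‖ + (1 : ℕ)) := norm_le_maxMod hg (by simp)
  have h2 := norm_nonneg z
  have h1 := maxMod_nonneg g (‖z‖ + (1 : ℕ))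
  rw [pow_one]
  unfold growthBase
  push_cast at h0 h1 ⊢
  nlinarith [mul_nonneg h2 h1]

lemma neg (h : Tame g f) : Tame g (fun z ↦ -f z) := by simpa [Tame] using h

lemma sub (hg : Continuous g) (h₁ : Tame g f₁) (h₂ : Tame g f₂) :
    Tame g (fun z ↦ f₁ z - f₂ z) := by
  simpa only [sub_eq_add_neg] using h₁.add hg h₂.neg

lemma eval (hg : Continuous g) (P : ℂ[X]) : Tame g (fun z ↦ P.eval z) := by
  induction P using Polynomial.induction_on' with
  | add p q hp hq => simpa using hp.add hg hq
  | monomial n c =>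
    simp only [eval_monomial]
    refine (const g c).mul hg ?_
    induction n with
    | zero => simpa using const g 1
    | succ n ih => simpa only [pow_succ] using ih.mul hg (id g)

lemma comp_add (hg : Continuous g) (h : Tame g f) (c : ℂ) : Tame g (fun z ↦ f (z + c)) := by
  obtain ⟨N, h⟩ := h
  obtain ⟨n, hn⟩ := exists_nat_ge ‖c‖
  refine ⟨N + n, fun z ↦ ?_⟩
  have hX := two_le_growthBase g (N + n) (norm_nonneg z)
  have hX' := two_le_growthBase g N (norm_nonneg (z + c))
  calc ‖f (z + c)‖ ≤ growthBase g N ‖z + c‖ ^ N := h _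
    _ ≤ growthBase g (N + n) ‖z‖ ^ N := by
      gcongr
      refine growthBase_mono hg (norm_nonneg _) ?_
      push_cast
      linarith [norm_add_le z c]
    _ ≤ growthBase g (N + n) ‖z‖ ^ (N + n) := pow_le_pow_right₀ (by linarith) (by omega)

lemma deriv (hg : Continuous g) (hf : Differentiable ℂ f) (h : Tame g f) :
    Tame g (deriv f) := by
  obtain ⟨N, h⟩ := h
  refine ⟨N + 1, fun z ↦ ?_⟩
  have hX := two_le_growthBase g (N + 1) (norm_nonneg z)
  have : ‖_root_.deriv f z‖ ≤ growthBase g (N + 1) ‖z‖ ^ N / 1 := by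
    -- Cauchy's estimate on the unit circle around `z`; the radius grows by one, hence `N + 1`.
    refine Complex.norm_deriv_le_of_forall_mem_sphere_norm_le one_pos hf.diffContOnCl ?_
    intro w hw
    refine (h w).trans ?_
    have hX' := two_le_growthBase g N (norm_nonneg w)
    gcongr
    refine growthBase_mono hg (norm_nonneg _) ?_
    have : ‖w‖ ≤ ‖z‖ + ‖w - z‖ := by simpa using norm_add_le z (w - z)
    rw [mem_sphere_iff_norm.1 hw] at this
    push_cast
    linarith
  rw [div_one] at this
  exact this.trans (pow_le_pow_right₀ (by linarith) (by omega))

end Tame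

/-! ### Characteristic of `e^f` and the size of `f` -/

lemma characteristic_top_of_differentiable {F : ℂ → ℂ} (hF : Differentiable ℂ F) (r : ℝ) :
    characteristic F ⊤ r = circleAverage (log⁺ ‖F ·‖) 0 r := by
  have h0 : (MeromorphicOn.divisor F Set.univ)⁻ = 0 :=
    negPart_eq_zero.2 (MeromorphicOn.AnalyticOnNhd.divisor_nonneg
      (hF.differentiableOn.analyticOnNhd isOpen_univ))
  simp [characteristic, logCounting_top, proximity_top, h0]

lemma characteristic_top_le_posLog {F : ℂ → ℂ} (hF : Differentiable ℂ F) {r b : ℝ} (hr : 0 ≤ r)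
    (h : ∀ z, ‖z‖ = r → ‖F z‖ ≤ b) : characteristic F ⊤ r ≤ log⁺ b := by
  rw [characteristic_top_of_differentiable hF]
  refine circleAverage_mono_on_of_le_circle
    (MeromorphicOn.circleIntegrable_posLog_norm
      fun x _ ↦ (hF.analyticAt x).meromorphicAt) fun z hz ↦ ?_
  have : ‖z‖ = r := by simpa [abs_of_nonneg hr] using hz
  exact posLog_le_posLog (norm_nonneg _) (h z this)

lemma meromorphicOrderAt_ne_top {D : ℂ → ℂ} (hD : Differentiable ℂ D) {z₀ : ℂ} (h0 : D z₀ ≠ 0)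
    (z : ℂ) : meromorphicOrderAt D z ≠ ⊤ := by
  have hA : AnalyticOnNhd ℂ D Set.univ := hD.differentiableOn.analyticOnNhd isOpen_univ
  rw [(hA z trivial).meromorphicOrderAt_eq]
  intro h
  have h' : analyticOrderAt D z = ⊤ := by simpa using h
  rw [analyticOrderAt_eq_top] at h'
  exact h0 (congrFun (hA.eq_of_eventuallyEq (g := 0) (fun _ _ ↦ analyticAt_const) h') z₀)

/-- If `D e^f = H` with `D` entire and not identically zero, then the characteristic of `e^f` is
controlled by those of `H` and `D`. -/
lemma characteristic_exp_le {D f H : ℂ → ℂ} (hD : Differentiable ℂ D) {z₀ : ℂ} (h0 : D z₀ ≠ 0)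
    (hf : Differentiable ℂ f) (h : ∀ z, D z * Complex.exp (f z) = H z) :
    ∃ C, ∀ r, 1 ≤ r → characteristic (fun z ↦ Complex.exp (f z)) ⊤ r ≤
      characteristic H ⊤ r + characteristic D ⊤ r + C := by
  have hH : Differentiable ℂ H := by
    have : H = fun z ↦ D z * Complex.exp (f z) := funext fun z ↦ (h z).symm
    rw [this]; fun_prop
  have hDm : Meromorphic D := fun z ↦ (hD.analyticAt z).meromorphicAt
  have hHm : Meromorphic H := fun z ↦ (hH.analyticAt z).meromorphicAt
  have hH0 : H z₀ ≠ 0 := by rw [← h]; exact mul_ne_zero h0 (Complex.exp_ne_zero _)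
  refine ⟨max |log ‖D 0‖| |log ‖meromorphicTrailingCoeffAt D 0‖|, fun r hr ↦ ?_⟩
  have e : (fun z ↦ Complex.exp (f z)) =ᶠ[codiscrete ℂ] H * D⁻¹ := by
    have hA : AnalyticOnNhd ℂ D Set.univ := hD.differentiableOn.analyticOnNhd isOpen_univ
    have := hA.preimage_zero_mem_codiscrete (x := z₀) h0 
    filter_upwards [this] with z hz
    have hz : D z ≠ 0 := hz
    simp only [Pi.mul_apply, Pi.inv_apply, ← h]
    field_simp
  rw [characteristic_congr_codiscrete e (by linarith)]
  have h1 := characteristic_mul_top_le hr hHm (meromorphicOrderAt_ne_top hH hH0) hDm.inv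
    (fun z ↦ by
      rw [meromorphicOrderAt_inv]
      simpa using meromorphicOrderAt_ne_top hD h0 z)
  -- First main theorem: `D` and `1 / D` have the same characteristic up to a constant.
  have h2 := neg_le_of_abs_le (characteristic_sub_characteristic_inv_le hDm (R := r))
  rw [Pi.add_apply] at h1
  linarith

/-- Poisson's formula writes `Re f` as an average against a positive kernel, which is at most `(R +
|z|) / (R - |z|) ≤ 2 R` since `z` is at distance more than one from the circle; and `Re f ≤ log⁺
|e^f|`. -/
lemma re_le_characteristic_exp {f : ℂ → ℂ} (hf : Differentiable ℂ f) {R : ℝ} (hR : 2 ≤ R) {z : ℂ}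
    (hz : ‖z‖ < R - 1) : (f z).re ≤ 2 * R * characteristic (fun z ↦ Complex.exp (f z)) ⊤ R := by
  have hz' : z ∈ ball (0 : ℂ) R := by simpa using hz.trans (by linarith)
  have hint : CircleIntegrable (fun w ↦ log⁺ ‖Complex.exp (f w)‖) 0 R :=
    MeromorphicOn.circleIntegrable_posLog_norm fun x _ ↦
      ((hf.cexp).analyticAt x).meromorphicAt
  have hRpos : 0 < R := by linarith
  have hP := DiffContOnCl.circleAverage_re_herglotzRieszKernel_smul (c := 0) hf.diffContOnCl hz'
  have hcont : ContinuousOn ((Complex.re ∘ herglotzRieszKernel 0 z) • f) (sphere 0 |R|) :=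
    (Complex.continuous_re.comp_continuousOn
      (continuousOn_herglotzRieszKernel_sphere hz')).smul hf.continuous.continuousOn
  have hcomm := Complex.reCLM.circleAverage_comp_comm hcont.circleIntegrable'
  rw [hP, Complex.reCLM_apply] at hcomm
  have hsmul := circleAverage_fun_smul (a := 2 * R) (f := fun w ↦ log⁺ ‖Complex.exp (f w)‖)
    (c := 0) (R := R)
  rw [characteristic_top_of_differentiable hf.cexp, ← smul_eq_mul, ← hsmul, ← hcomm]
  refine circleAverage_mono
    (Complex.continuous_re.comp_continuousOn hcont).circleIntegrable' (hint.const_smul) ?_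
  intro w hw
  have hw : w ∈ sphere (0 : ℂ) R := by simpa [abs_of_pos hRpos] using hw
  have hlog : (f w).re ≤ log⁺ ‖Complex.exp (f w)‖ := by
    rw [Complex.norm_exp]
    exact (Real.log_exp (f w).re).symm.le.trans (le_max_right _ _)
  have h1 := re_herglotzRieszKernel_le hw hz'
  have h2 := le_re_herglotzRieszKernel hw hz'
  simp only [sub_zero] at h1 h2
  have h3 : (R + ‖z‖) / (R - ‖z‖) ≤ 2 * R := by
    rw [div_le_iff₀ (by linarith)]
    nlinarith [norm_nonneg z]
  have h4 : 0 ≤ (R - ‖z‖) / (R + ‖z‖) :=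
    div_nonneg (by linarith [norm_nonneg z]) (by linarith [norm_nonneg z])
  have e : (Complex.reCLM ∘ ((Complex.re ∘ herglotzRieszKernel 0 z) • f)) w =
      ((w + z) / (w - z)).re * (f w).re := by
    simp [herglotzRieszKernel_def]
  rw [e, smul_eq_mul]
  exact (mul_le_mul_of_nonneg_left hlog (h4.trans h2)).trans
    (mul_le_mul_of_nonneg_right (h1.trans h3) posLog_nonneg)

/-- The size of an entire function `f` is controlled by the characteristic of `e^f`. -/
lemma exists_norm_le_characteristic_exp {f : ℂ → ℂ} (hf : Differentiable ℂ f) :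
    ∃ K : ℝ, 1 ≤ K ∧ ∀ R, 2 ≤ R → ∀ z, ‖z‖ ≤ R - 2 →
      ‖f z‖ ≤ K * R ^ 2 * (characteristic (fun z ↦ Complex.exp (f z)) ⊤ R + 1) := by
  refine ⟨6 + 2 * ‖f 0‖, by linarith [norm_nonneg (f 0)], fun R hR z hz ↦ ?_⟩
  have hT : 0 ≤ characteristic (fun z ↦ Complex.exp (f z)) ⊤ R :=
    characteristic_nonneg (by linarith)
  set T := characteristic (fun z ↦ Complex.exp (f z)) ⊤ R
  -- The radius `R - 1` leaves unit gaps on both sides: to the Poisson circle and to the disc of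
  -- radius `R - 2`. The `+ 1` in `M` keeps the bound positive.
  have := Complex.borelCaratheodory (f := f) (M := 2 * R * T + 1) (R := R - 1) (z := z)
    (by positivity) hf.differentiableOn
    (fun w hw ↦ (re_le_characteristic_exp hf hR (by simpa using hw)).trans (by simp [T]))
    (by linarith) (by simp; linarith)
  have hd : 1 ≤ R - 1 - ‖z‖ := by linarith
  have hz0 := norm_nonneg z
  have hf0 := norm_nonneg (f 0)
  calc ‖f z‖ ≤ _ := this
    _ ≤ 2 * (2 * R * T + 1) * ‖z‖ + ‖f 0‖ * (R - 1 + ‖z‖) := by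
      gcongr
      · exact div_le_self (by positivity) hd
      · refine div_le_self (mul_nonneg hf0 (by linarith)) hd
    _ ≤ 2 * (2 * R * T + 1) * R + ‖f 0‖ * (2 * R) := by
      gcongr <;> linarith
    _ ≤ (6 + 2 * ‖f 0‖) * R ^ 2 * (T + 1) := by
      have a1 : R ≤ R ^ 2 := by nlinarith
      have a2 : ‖f 0‖ * R ≤ ‖f 0‖ * R ^ 2 := by gcongr
      have a3 : 0 ≤ ‖f 0‖ * R ^ 2 * T := by positivity
      have a4 : 0 ≤ R ^ 2 * T := by positivity
      nlinarith

/-! ### Growth recursion and towers of exponentials -/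

/-- One step of the growth recursion. -/
lemma exp_sqrt_le_of_recursion {M M' R K s : ℝ} (hK : 1 ≤ K) (hs : 0 ≤ s) (hRs : s ≤ R)
    (hRK : 16 * K ≤ R) (hM : R ^ 6 ≤ M) (hMM' : M ≤ M')
    (h : M ≤ K * (R + s) ^ 2 * (log (R + s) + log (1 + M') + 1)) :
    exp √M ≤ √M' ∧ (R + s) ^ 6 ≤ M' := by
  have hR : 16 ≤ R := by linarith
  have hM0 : 0 ≤ M := (by positivity : (0 : ℝ) ≤ R ^ 6).trans hM
  have ht : R ^ 3 ≤ √M := le_sqrt_of_sq_le (by calc (R ^ 3) ^ 2 = R ^ 6 := by ring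
    _ ≤ M := hM)
  have htM : √M * √M = M := mul_self_sqrt hM0
  set t := √M
  have hR3 : 0 < R ^ 3 := by positivity
  have ht0 : 0 < t := by linarith
  have hRt : 2 * R ≤ t := by nlinarith [mul_pos (show 0 < R by linarith) (show 0 < R by linarith)]
  have hlog0 : 0 ≤ log (1 + M') := log_nonneg (by linarith)
  have hlogR : log (R + s) + 1 ≤ t := by
    have := log_le_sub_one_of_pos (show 0 < R + s by linarith)
    linarith
  have hsq : (R + s) ^ 2 ≤ 4 * R ^ 2 := by nlinarith
  have h1 : t * t ≤ K * (4 * R ^ 2) * (t + log (1 + M')) := by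
    rw [htM]
    refine h.trans ?_
    have := log_nonneg (show 1 ≤ R + s by linarith)
    exact mul_le_mul (mul_le_mul_of_nonneg_left hsq (by linarith)) (by linarith) (by linarith)
      (by positivity)
  -- The threshold `R ^ 6` is used here: `t = √M ≥ R ^ 3` dominates the factor `16 K R ^ 2`.
  have h2 : 16 * K * R ^ 2 ≤ t := by nlinarith [sq_nonneg R]
  -- The factor 3 is slack: `exp (3 t) ≤ 1 + M'` yields `exp (2 t) ≤ M'`, the square of the bound
  -- wanted.
  have h3 : 3 * t ≤ log (1 + M') := by
    by_contra! hlt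
    have : t * t < t * t := calc
      t * t ≤ K * (4 * R ^ 2) * (t + log (1 + M')) := h1
      _ < K * (4 * R ^ 2) * (t + 3 * t) := by gcongr
      _ = 16 * K * R ^ 2 * t := by ring
      _ ≤ t * t := by gcongr
    exact lt_irrefl _ this
  have h4 : exp (3 * t) ≤ 1 + M' := (le_log_iff_exp_le (by linarith)).1 h3
  have h5 : exp t ^ 2 ≤ M' := by
    have e : exp (3 * t) = exp t ^ 2 * exp t := by
      rw [← pow_succ, ← exp_nat_mul]; norm_num
    have e1 := add_one_le_exp t
    nlinarith [sq_nonneg (exp t - 1)]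
  refine ⟨le_sqrt_of_sq_le h5, le_trans ?_ h5⟩
  have e1 : R + s ≤ exp (2 * R) := by linarith [add_one_le_exp (2 * R)]
  calc (R + s) ^ 6 ≤ exp (2 * R) ^ 6 := by gcongr
    _ = exp (6 * R) ^ 2 := by rw [← exp_nat_mul, ← exp_nat_mul]; congr 1; push_cast; ring
    _ ≤ exp t ^ 2 := by
      gcongr
      nlinarith [mul_pos (show 0 < R by linarith) (show 0 < R by linarith)]

lemma exp_iterate_mono (n : ℕ) : Monotone (exp^[n]) := exp_monotone.iterate n

lemma exp_iterate_strictMono (n : ℕ) : StrictMono (exp^[n]) := exp_strictMono.iterate n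

lemma natCast_le_exp_iterate_zero (n : ℕ) : (n : ℝ) ≤ exp^[n] 0 := by
  induction n with
  | zero => simp
  | succ n ih =>
    rw [Function.iterate_succ_apply']
    push_cast
    linarith [add_one_le_exp (exp^[n] 0)]

lemma le_exp_iterate (n : ℕ) (x : ℝ) : x ≤ exp^[n] x := by
  induction n with
  | zero => simp
  | succ n ih =>
    rw [Function.iterate_succ_apply']
    linarith [add_one_le_exp (exp^[n] x)]

/-- Valid for every real `x`, because `x ≤ exp (log x)` survives the default values of `log` at
nonpositive arguments. -/
lemma le_exp_iterate_log_iterate (n : ℕ) (x : ℝ) : x ≤ exp^[n] (log^[n] x) := by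
  induction n generalizing x with
  | zero => simp
  | succ n ih =>
    rw [Function.iterate_succ_apply', Function.iterate_succ_apply]
    exact (le_exp_log x).trans (exp_le_exp.2 (ih _))

/-- A function satisfying the growth recursion and exceeding `R ^ 6` for arbitrarily large `R`
grows like an iterated exponential. -/
lemma exists_exp_iterate_le {M : ℝ → ℝ} (hmono : ∀ r s, 0 ≤ r → r ≤ s → M r ≤ M s)
    {K s : ℝ} (hK : 1 ≤ K) (hs : 0 ≤ s)
    (hrec : ∀ R, 0 ≤ R → M R ≤ K * (R + s) ^ 2 * (log (R + s) + log (1 + M (R + s)) + 1))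
    (hfreq : ∃ᶠ R in atTop, R ^ 6 ≤ M R) :
    ∃ R₀, 1 ≤ R₀ ∧ ∀ n : ℕ, exp^[n] 0 ≤ M (R₀ + s * n) := by
  obtain ⟨R₀, h₀, hge⟩ :=
    (hfreq.and_eventually (eventually_ge_atTop (max s (16 * K)))).exists
  have hR₀s : s ≤ R₀ := (le_max_left _ _).trans hge
  have hR₀K : 16 * K ≤ R₀ := (le_max_right _ _).trans hge
  -- The sixth-power bound is carried along so that the one-step estimate applies again at the next
  -- radius.
  have key : ∀ n : ℕ, (R₀ + s * n) ^ 6 ≤ M (R₀ + s * n) ∧ exp^[n] 0 ≤ √(M (R₀ + s * n)) := by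
    intro n
    induction n with
    | zero => simpa using h₀
    | succ n ih =>
      have hn : 0 ≤ s * n := by positivity
      have e : R₀ + s * ((n + 1 : ℕ) : ℝ) = R₀ + s * n + s := by push_cast; ring
      have step := exp_sqrt_le_of_recursion hK hs (by linarith) (by linarith) ih.1
        (hmono _ (R₀ + s * n + s) (by linarith) (by linarith)) (hrec (R₀ + s * n) (by linarith))
      rw [e, Function.iterate_succ_apply']
      exact ⟨step.2, (exp_le_exp.2 ih.2).trans step.1⟩
  refine ⟨R₀, by linarith, fun n ↦ (key n).2.trans ?_⟩
  have hn : 0 ≤ s * n := by positivity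
  have h1 : 1 ≤ M (R₀ + s * n) := (one_le_pow₀ (by linarith)).trans (key n).1
  rw [sqrt_le_left (by linarith)]
  nlinarith

/-- A bound by an iterated exponential of `C * log R` excludes iterated exponential growth. -/
lemma false_of_exp_iterate_le {M T : ℝ → ℝ} {K s C R₀ : ℝ} {i : ℕ} (hi : 1 ≤ i) (hs : 0 < s)
    (hK : 0 ≤ K) (hR₀ : 0 ≤ R₀) (hlower : ∀ n : ℕ, exp^[n] 0 ≤ M (R₀ + s * n))
    (hM : ∀ᶠ R in atTop, M (R - 2) ≤ K * R ^ 3 * (T R + K))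
    (hT : ∀ᶠ R in atTop, T R ≤ exp^[i] (C * log R))
    (hT0 : ∀ᶠ R in atTop, 0 ≤ T R) : False := by
  -- Two further exponentials absorb the polynomial factors; `max C 1` ensures that `R` is itself
  -- below the tower `E`.
  have hupper : ∀ᶠ R in atTop, M (R - 2) ≤ exp^[i + 2] (max C 1 * log R) := by
    filter_upwards [hM, hT, hT0, eventually_ge_atTop K, eventually_ge_atTop 12] with R h1 h2 h0 h3 h4
    have hlog : 0 ≤ log R := log_nonneg (by linarith)
    set E := exp^[i] (max C 1 * log R) with hE
    have hTE : T R ≤ E := h2.trans (exp_iterate_mono i (by gcongr; exact le_max_left _ _))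
    have hRE : R ≤ E := by
      obtain ⟨j, rfl⟩ : ∃ j, i = j + 1 := ⟨i - 1, by omega⟩
      rw [hE, Function.iterate_succ_apply]
      refine le_trans ?_ (le_exp_iterate j _)
      calc R = exp (log R) := (exp_log (by linarith)).symm
        _ ≤ exp (max C 1 * log R) := by
          gcongr
          nlinarith [le_max_right C 1]
    have hE12 : 12 ≤ E := h4.trans hRE
    rw [show i + 2 = 2 + i from add_comm _ _, Function.iterate_add_apply, ← hE]
    have e0 : exp^[2] E = exp (exp E) := rfl
    rw [e0]
    have e1 : 6 * E ≤ exp E := by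
      have := quadratic_le_exp_of_nonneg (show 0 ≤ E by linarith)
      nlinarith
    calc M (R - 2) ≤ K * R ^ 3 * (T R + K) := h1
      _ ≤ E * E ^ 3 * (E + E) := by
        gcongr
        · linarith
        · linarith
      _ = 2 * E ^ 5 := by ring
      _ ≤ E * E ^ 5 := by gcongr; linarith
      _ = E ^ 6 := by ring
      _ ≤ exp E ^ 6 := by gcongr; linarith [add_one_le_exp E]
      _ = exp (6 * E) := by rw [← exp_nat_mul]; norm_num
      _ ≤ exp (exp E) := exp_le_exp.2 e1
  have htend : Tendsto (fun n : ℕ ↦ R₀ + s * (n : ℝ) + 2) atTop atTop :=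
    tendsto_atTop_add_const_right _ _ (tendsto_atTop_add_const_left _ _
      (tendsto_natCast_atTop_atTop.const_mul_atTop hs))
  have hsmall : ∀ᶠ n : ℕ in atTop,
      max C 1 * log (R₀ + s * n + 2) < n - (i + 2 : ℕ) := by
    have ho := (isLittleO_log_id_atTop.comp_tendsto htend).bound
      (show 0 < 1 / (2 * s * max C 1) by positivity)
    filter_upwards [ho, tendsto_natCast_atTop_atTop.eventually_gt_atTop
      (2 * ((i + 2 : ℕ) + (R₀ + 2) / (2 * s)))] with n hn hn'
    have hC : 0 < max C 1 := lt_max_of_lt_right one_pos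
    have hx : 0 ≤ R₀ + s * (n : ℝ) + 2 := by positivity
    simp only [Function.comp_apply, norm_eq_abs, id, abs_of_nonneg hx] at hn
    calc max C 1 * log (R₀ + s * n + 2)
        ≤ max C 1 * (1 / (2 * s * max C 1) * (R₀ + s * n + 2)) := by
          gcongr
          exact (le_abs_self _).trans hn
      _ = n / 2 + (R₀ + 2) / (2 * s) := by field_simp; ring
      _ < n - (i + 2 : ℕ) := by linarith
  obtain ⟨n, h1, h2, h3⟩ := ((htend.eventually hupper).and
    (hsmall.and (eventually_ge_atTop (i + 2)))).exists
  rw [add_sub_cancel_right] at h1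
  have h4 := (hlower n).trans h1
  -- Cancelling `i + 2` exponentials leaves a tower of height `m`, at least `m`, below a logarithm
  -- of a linear function of `n`.
  obtain ⟨m, rfl⟩ : ∃ m, n = (i + 2) + m := ⟨n - (i + 2), by omega⟩
  rw [Function.iterate_add_apply, (exp_iterate_strictMono _).le_iff_le] at h4
  have h5 := (natCast_le_exp_iterate_zero m).trans h4
  push_cast at h2 h5
  linarith

/-! ### Pointwise consequences of the order hypotheses -/

lemma HasFiniteIteratedOrder.exists_le {w : ℂ → ℂ} (h : HasFiniteIteratedOrder w) :
    ∃ (i : ℕ) (C : ℝ), 1 ≤ i ∧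
      ∀ᶠ r in atTop, characteristic w ⊤ r ≤ exp^[i] (C * log r) := by
  obtain ⟨i, hi, h⟩ := h
  obtain ⟨C, hC, -⟩ := EReal.lt_iff_exists_real_btwn.1 h
  refine ⟨i, C, by omega, ?_⟩
  filter_upwards [eventually_lt_of_limsup_lt hC, eventually_gt_atTop 1] with r hr h1
  have hr : log^[i] (characteristic w ⊤ r) / log r < C := by exact_mod_cast hr
  rw [div_lt_iff₀ (log_pos h1)] at hr
  exact (le_exp_iterate_log_iterate i _).trans (exp_iterate_mono i hr.le)

lemma HasInfiniteOrder.frequently_pow_lt {w : ℂ → ℂ} (h : HasInfiniteOrder w) (k : ℕ) :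
    ∃ᶠ r in atTop, r ^ k < characteristic w ⊤ r := by
  have h0 : ((k : ℝ) : EReal) < iteratedOrder 1 w := by rw [h]; exact EReal.coe_lt_top _
  refine ((frequently_lt_of_lt_limsup (by isBoundedDefault) h0).and_eventually
    (eventually_gt_atTop 1)).mono ?_
  rintro r ⟨hr, h1⟩
  have hr : (k : ℝ) < log (characteristic w ⊤ r) / log r := by exact_mod_cast hr
  rw [lt_div_iff₀ (log_pos h1)] at hr
  have hlog : 0 < log (characteristic w ⊤ r) :=
    lt_of_le_of_lt (mul_nonneg k.cast_nonneg (log_pos h1).le) hr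
  -- The value zero is excluded because `log 0 = 0` by convention, while the logarithm here is
  -- positive.
  have hT : 0 < characteristic w ⊤ r := by
    refine (characteristic_nonneg h1.le).lt_of_ne' fun h ↦ ?_
    simp [h] at hlog
  rw [← log_pow] at hr
  exact (log_lt_log_iff (by positivity) hT).1 hr

/-! ### Uniqueness and factorization of entire functions -/

lemma analyticOnNhd_univ {f : ℂ → ℂ} (hf : Differentiable ℂ f) : AnalyticOnNhd ℂ f Set.univ :=
  hf.differentiableOn.analyticOnNhd isOpen_univ

/-- An entire solution of a regular first order linear differential equation vanishing at the
initial point vanishes identically. -/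
lemma eq_zero_of_mul_deriv_eq {f u v : ℂ → ℂ} (hf : Differentiable ℂ f) (hu : Differentiable ℂ u)
    (hv : Differentiable ℂ v) (h : ∀ z, u z * deriv f z = f z * v z) {z₀ : ℂ} (h0 : f z₀ = 0)
    (hu0 : u z₀ ≠ 0) : f = 0 := by
  rw [← AnalyticOnNhd.analyticOrderAt_eq_top_iff_eq_zero z₀ hf.analyticAt]
  by_contra hne
  have h1 := (hf.analyticAt z₀).analyticOrderAt_deriv_add_one
  simp only [h0, sub_zero] at h1
  have h2 : analyticOrderAt (u * deriv f) z₀ = analyticOrderAt (f * v) z₀ := by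
    congr 1
    exact funext h
  rw [analyticOrderAt_mul (hu.analyticAt z₀) (hf.analyticAt z₀).deriv,
    analyticOrderAt_mul (hf.analyticAt z₀) (hv.analyticAt z₀),
    (hu.analyticAt z₀).analyticOrderAt_eq_zero.2 hu0, zero_add] at h2
  -- The equation makes `f'` vanish at least to the order of `f`, whereas differentiation lowers a
  -- finite positive order by one.
  have h3 : analyticOrderAt f z₀ ≤ analyticOrderAt (deriv f) z₀ := by rw [h2]; exact le_self_add
  rw [← h1] at h3 hne
  generalize analyticOrderAt (deriv f) z₀ = n at h3 hne
  cases n with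
  | top => simp at hne
  | coe n =>
    have : n + 1 ≤ n := by exact_mod_cast h3
    omega

lemma eq_zero_or_eq_zero_of_mul_eq_zero {f g : ℂ → ℂ} (hf : Differentiable ℂ f)
    (hg : Differentiable ℂ g) (h : ∀ z, f z * g z = 0) : (∀ z, f z = 0) ∨ ∀ z, g z = 0 := by
  simpa using (analyticOnNhd_univ hf).eq_zero_or_eq_zero_of_mul_eq_zero (analyticOnNhd_univ hg)
    (fun z _ ↦ h z) isPreconnected_univ

/-- Entire functions with vanishing Wronskian are linearly dependent. -/
lemma exists_eq_const_mul {F G : ℂ → ℂ} (hF : Differentiable ℂ F) (hG : Differentiable ℂ G)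
    (h : ∀ z, deriv F z * G z = F z * deriv G z) {z₀ : ℂ} (h0 : G z₀ ≠ 0) :
    ∃ c, ∀ z, F z = c * G z := by
  refine ⟨F z₀ / G z₀, fun z ↦ ?_⟩
  set c := F z₀ / G z₀
  have hd (z : ℂ) : deriv (fun z ↦ F z - c * G z) z = deriv F z - c * deriv G z := by
    rw [deriv_fun_sub (hF z) ((hG z).const_mul c), deriv_const_mul _ (hG z)]
  have := eq_zero_of_mul_deriv_eq (f := fun z ↦ F z - c * G z) (u := G) (v := deriv G)
    (hF.sub (hG.const_mul c)) hG hG.deriv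
    (fun z ↦ by rw [hd]; linear_combination h z) (z₀ := z₀) (by simp [c, h0]) h0
  exact sub_eq_zero.1 (congrFun this z)

/-- An entire function without zeros is the exponential of an entire function. -/
lemma exists_exp_eq {v : ℂ → ℂ} (hv : Differentiable ℂ v) (h0 : ∀ z, v z ≠ 0) :
    ∃ g, Differentiable ℂ g ∧ ∀ z, v z = Complex.exp (g z) := by
  obtain ⟨G, hG⟩ := (hv.deriv.div hv h0).isExactOn_univ
  have hG (z : ℂ) : HasDerivAt G (deriv v z / v z) z := hG z trivial
  have hGd : Differentiable ℂ G := fun z ↦ (hG z).differentiableAt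
  obtain ⟨c, hc⟩ := exists_eq_const_mul hv hGd.cexp
    (fun z ↦ by
      rw [((hG z).cexp).deriv]
      field_simp [h0 z]) (Complex.exp_ne_zero (G 0))
  have hc0 : c ≠ 0 := by
    rintro rfl
    exact h0 0 (by simp [hc])
  refine ⟨fun z ↦ Complex.log c + G z, by fun_prop, fun z ↦ ?_⟩
  rw [Complex.exp_add, Complex.exp_log hc0, hc]

/-- An entire function with finitely many zeros is a polynomial times the exponential of an
entire function. -/
lemma exists_eq_eval_mul_exp {w : ℂ → ℂ} (hw : Differentiable ℂ w) {z₀ : ℂ} (h0 : w z₀ ≠ 0)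
    (hfin : {z | w z = 0}.Finite) :
    ∃ (P : ℂ[X]) (g : ℂ → ℂ), P ≠ 0 ∧ Differentiable ℂ g ∧
      ∀ z, w z = P.eval z * Complex.exp (g z) := by
  have hA := analyticOnNhd_univ hw
  have hsupp : (MeromorphicOn.divisor w Set.univ).support ⊆ {z | w z = 0} := by
    intro z hz
    by_contra hne
    refine hz ?_
    rw [MeromorphicOn.AnalyticOnNhd.divisor_apply hA trivial,
      (hA z trivial).analyticOrderAt_eq_zero.2 hne]
    rfl
  have hfin' := hfin.subset hsupp
  obtain ⟨v, hv, hv0, hwv⟩ := hA.meromorphicOn.extract_zeros_poles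
    (fun u ↦ meromorphicOrderAt_ne_top hw h0 u) hfin'
  set d := MeromorphicOn.divisor w Set.univ with hd
  have hd0 (u : ℂ) : 0 ≤ d u := MeromorphicOn.AnalyticOnNhd.divisor_nonneg hA u
  set P : ℂ[X] := ∏ u ∈ hfin'.toFinset, (X - C u) ^ (d u).toNat with hP
  have hPne : P ≠ 0 := Finset.prod_ne_zero_iff.2 fun u _ ↦ pow_ne_zero _ (X_sub_C_ne_zero u)
  have hvd : Differentiable ℂ v := fun z ↦ (hv z trivial).differentiableAt
  obtain ⟨g, hg, hvg⟩ := exists_exp_eq hvd (fun z ↦ hv0 ⟨z, trivial⟩)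
  refine ⟨P, g, hPne, hg, ?_⟩
  have hprod (z : ℂ) : (∏ᶠ u, (· - u) ^ d u : ℂ → ℂ) z = P.eval z := by
    have : (fun u : ℂ ↦ ((· - u) ^ d u : ℂ → ℂ)).mulSupport ⊆ hfin'.toFinset := by
      rw [Function.FactorizedRational.mulSupport]
      simp
    rw [finprod_eq_prod_of_mulSupport_subset _ this, hP, eval_prod, Finset.prod_apply]
    refine Finset.prod_congr rfl fun u _ ↦ ?_
    simp only [Pi.pow_apply, eval_pow, eval_sub, eval_X, eval_C]
    rw [← zpow_natCast, Int.toNat_of_nonneg (hd0 u)]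
  -- The factorization is known only off a discrete set; the identity theorem extends it to the
  -- plane.
  have hcod : ∀ᶠ z in codiscreteWithin Set.univ, w z = P.eval z * v z := by
    filter_upwards [hwv] with z hz
    rw [hz, Pi.smul_apply', hprod, smul_eq_mul]
  have hev : ∀ᶠ z in nhdsWithin (0 : ℂ) {0}ᶜ, w z = P.eval z * v z := by
    simpa [Filter.Eventually] using mem_codiscreteWithin_iff_forall_mem_nhdsNE.1 hcod 0 trivial
  have heq := hA.eq_of_frequently_eq (g := fun z ↦ P.eval z * v z)
    (analyticOnNhd_univ (P.differentiable.mul hvd)) hev.frequently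
  intro z
  rw [← hvg]
  exact congrFun heq z

/-! ### Reduction to `w = P e^g` -/

/-- Clearing denominators in the delay-differential equation. -/
lemma IsEntireSolution.exists_polynomial_identity {a a₀ : RatFunc ℂ} (ha : a ≠ 0) {w : ℂ → ℂ}
    (h : IsEntireSolution a a₀ w) :
    ∃ A B C : ℂ[X], A ≠ 0 ∧ B ≠ 0 ∧ ∀ z,
      A.eval z * w z * (w (z + 1) - w (z - 1)) + B.eval z * deriv w z = C.eval z * w z := by
  refine ⟨a.denom * a₀.denom, a.num * a₀.denom, a₀.num * a.denom,
    mul_ne_zero a.denom_ne_zero a₀.denom_ne_zero,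
    mul_ne_zero (RatFunc.num_ne_zero ha) a₀.denom_ne_zero, ?_⟩
  set A := a.denom * a₀.denom with hA
  have hw := h.entire
  have hA0 : A ≠ 0 := mul_ne_zero a.denom_ne_zero a₀.denom_ne_zero
  obtain ⟨z₀, hz₀⟩ := h.ne_zero
  have hw' := hw.deriv
  have hAd := A.differentiable
  -- The extra factor `A w` vanishes at the points where the equation is not assumed, so the product
  -- is zero everywhere and this factor can be cancelled.
  have key := eq_zero_or_eq_zero_of_mul_eq_zero
    (f := fun z ↦ A.eval z * w z)
    (g := fun z ↦ A.eval z * w z * (w (z + 1) - w (z - 1)) +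
      (a.num * a₀.denom).eval z * deriv w z - (a₀.num * a.denom).eval z * w z)
    (by fun_prop)
    (((hAd.mul hw).mul ((hw.comp (differentiable_id.add_const 1)).sub
      (hw.comp (differentiable_id.sub_const 1)))).add
      ((Polynomial.differentiable _).mul hw') |>.sub ((Polynomial.differentiable _).mul hw))
    (fun z ↦ by
      by_cases h1 : w z = 0
      · simp [h1]
      by_cases h2 : a.denom.eval z = 0
      · simp [hA, h2]
      by_cases h3 : a₀.denom.eval z = 0
      · simp [hA, h3]
      refine mul_eq_zero_of_right _ ?_
      have := h.equation z h1 h2 h3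
      simp only [ratValue, RatFunc.eval, eval₂_id] at this
      simp only [hA, eval_mul]
      field_simp at this
      linear_combination this)
  rcases key with key | key
  · exfalso
    rcases eq_zero_or_eq_zero_of_mul_eq_zero hAd hw key with h1 | h1
    · exact hA0 (Polynomial.funext fun z ↦ by simpa using h1 z)
    · exact hz₀ (h1 z₀)
  · exact fun z ↦ sub_eq_zero.1 (key z)

/-- A solution of the cleared equation has the form `P e^g`. -/
lemma exists_eval_mul_exp_of_identity {w : ℂ → ℂ} (hw : Differentiable ℂ w) {z₀ : ℂ}
    (h0 : w z₀ ≠ 0) {A B C : ℂ[X]} (hB : B ≠ 0)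
    (h : ∀ z, A.eval z * w z * (w (z + 1) - w (z - 1)) + B.eval z * deriv w z =
      C.eval z * w z) :
    ∃ (P : ℂ[X]) (g : ℂ → ℂ), P ≠ 0 ∧ Differentiable ℂ g ∧
      ∀ z, w z = P.eval z * Complex.exp (g z) := by
  refine exists_eq_eval_mul_exp hw h0 ((B.rootSet_finite ℂ).subset fun z hz ↦ ?_)
  rw [mem_rootSet]
  refine ⟨hB, ?_⟩
  rw [coe_aeval_eq_eval]
  by_contra hBz
  have := eq_zero_of_mul_deriv_eq hw B.differentiable
    (v := fun z ↦ C.eval z - A.eval z * (w (z + 1) - w (z - 1)))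
    (C.differentiable.sub (A.differentiable.mul ((hw.comp (differentiable_id.add_const 1)).sub
      (hw.comp (differentiable_id.sub_const 1)))))
    (fun z ↦ by linear_combination h z) hz hBz
  exact h0 (congrFun this z₀)

/-! ### Elimination of one exponential -/

/-- The alternative obtained by eliminating one of the two exponentials: either some shift of
`e^g` is a quotient of tame functions, or `g'` is rational. -/
lemma exists_tame_or_deriv_eq {g : ℂ → ℂ} (hg : Differentiable ℂ g) {A B C P : ℂ[X]}
    (hA : A ≠ 0) (hP : P ≠ 0)
    (h : ∀ z, A.eval z * (P.eval z * Complex.exp (g z)) *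
      (P.eval (z + 1) * Complex.exp (g (z + 1)) - P.eval (z - 1) * Complex.exp (g (z - 1))) +
      B.eval z * deriv (fun z ↦ P.eval z * Complex.exp (g z)) z =
        C.eval z * (P.eval z * Complex.exp (g z))) :
    (∃ (D H : ℂ → ℂ) (z₀ c : ℂ), ‖c‖ = 1 ∧ Differentiable ℂ D ∧ D z₀ ≠ 0 ∧ Tame g D ∧ Tame g H ∧
      ∀ z, D z * Complex.exp (g (z + c)) = H z) ∨
    ∃ Q : ℂ[X], ∀ z, (B * P).eval z * deriv g z = Q.eval z := by
  set P₁ := P.comp (X + Polynomial.C 1)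
  set P₂ := P.comp (X - Polynomial.C 1)
  set U := A * P * P₁ with hU
  set V := A * P * P₂ with hV
  have hP₂ : P₂ ≠ 0 := by
    have : P₂ = P.comp (X + Polynomial.C (-1)) := by simp [P₂, sub_eq_add_neg]
    rw [this]
    exact comp_X_add_C_ne_zero_iff.2 hP
  have hV0 : V ≠ 0 := mul_ne_zero (mul_ne_zero hA hP) hP₂
  obtain ⟨z₁, hz₁⟩ : ∃ z, V.eval z ≠ 0 := by
    by_contra! hne
    exact hV0 (Polynomial.funext fun z ↦ by simpa using hne z)
  have hgc := hg.continuous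
  have hg' := hg.deriv
  have tg : Tame g g := Tame.self hgc
  have tg' : Tame g (deriv g) := tg.deriv hgc hg
  set Q := C * P - B * derivative P with hQ
  set k : ℂ → ℂ := fun z ↦ Q.eval z - (B * P).eval z * deriv g z with hk
  have hkd : Differentiable ℂ k := Q.differentiable.sub ((B * P).differentiable.mul hg')
  have tk : Tame g k := (Tame.eval hgc Q).sub hgc ((Tame.eval hgc (B * P)).mul hgc tg')
  set F : ℂ → ℂ := fun z ↦ U.eval z * Complex.exp (g (z + 1)) with hF
  set G : ℂ → ℂ := fun z ↦ V.eval z * Complex.exp (g (z + -1)) with hG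
  have hFG (z : ℂ) : F z - G z = k z := by
    have h1 := h z
    have hd : deriv (fun z ↦ P.eval z * Complex.exp (g z)) z =
        (derivative P).eval z * Complex.exp (g z) +
          P.eval z * (Complex.exp (g z) * deriv g z) :=
      ((P.hasDerivAt z).mul (hg z).hasDerivAt.cexp).deriv
    rw [hd] at h1
    refine mul_right_cancel₀ (Complex.exp_ne_zero (g z)) ?_
    simp only [hF, hG, hk, hQ, hU, hV, P₁, P₂, eval_mul, eval_sub, eval_comp, eval_add, eval_X,
      eval_C, ← sub_eq_add_neg]
    linear_combination h1
  have hderiv (W : ℂ[X]) (c z : ℂ) :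
      HasDerivAt (fun z ↦ W.eval z * Complex.exp (g (z + c)))
        (((derivative W).eval z + W.eval z * deriv g (z + c)) * Complex.exp (g (z + c))) z := by
    have := (W.hasDerivAt z).mul ((hg (z + c)).hasDerivAt.comp_add_const z c).cexp
    exact this.congr_deriv (by ring)
  have hFd : Differentiable ℂ F := fun z ↦ (hderiv U 1 z).differentiableAt
  have hGd : Differentiable ℂ G := fun z ↦ (hderiv V (-1) z).differentiableAt
  have hk' (z : ℂ) : deriv k z = deriv F z - deriv G z := by
    rw [← deriv_fun_sub (hFd z) (hGd z)]
    exact congrArg (deriv · z) (funext fun z ↦ (hFG z).symm)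
  have hF' (z : ℂ) : deriv F z = _ := (hderiv U 1 z).deriv
  have hG' (z : ℂ) : deriv G z = _ := (hderiv V (-1) z).deriv
  set L : ℂ → ℂ := fun z ↦ (derivative V).eval z + V.eval z * deriv g (z + -1) with hL
  -- Up to sign, the determinant of the system `F - G = k`, `F' - G' = k'` in the unknowns
  -- `e^{g(z+1)}` and `e^{g(z-1)}`. Up to a nonvanishing factor it is also the Wronskian of `F` and
  -- `G`.
  set D : ℂ → ℂ := fun z ↦ U.eval z * L z -
    V.eval z * ((derivative U).eval z + U.eval z * deriv g (z + 1)) with hD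
  have hLd : Differentiable ℂ L :=
    (derivative V).differentiable.add (V.differentiable.mul (hg'.comp
      (differentiable_id.add_const (-1))))
  have tL : Tame g L := (Tame.eval hgc _).add hgc ((Tame.eval hgc V).mul hgc (tg'.comp_add hgc _))
  have hDd : Differentiable ℂ D :=
    (U.differentiable.mul hLd).sub (V.differentiable.mul ((derivative U).differentiable.add
      (U.differentiable.mul (hg'.comp (differentiable_id.add_const 1)))))
  have tD : Tame g D := ((Tame.eval hgc U).mul hgc tL).sub hgc ((Tame.eval hgc V).mul hgc
    ((Tame.eval hgc _).add hgc ((Tame.eval hgc U).mul hgc (tg'.comp_add hgc _))))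
  by_cases hD0 : ∃ z₀, D z₀ ≠ 0
  · obtain ⟨z₀, hz₀⟩ := hD0
    refine Or.inl ⟨D, fun z ↦ L z * k z - V.eval z * deriv k z, z₀, 1, by simp, hDd, hz₀, tD,
      (tL.mul hgc tk).sub hgc ((Tame.eval hgc V).mul hgc (tk.deriv hgc hkd)), fun z ↦ ?_⟩
    change D z * Complex.exp (g (z + 1)) = L z * k z - V.eval z * deriv k z
    rw [hk', hF', hG', ← hFG]
    simp only [hD, hF, hG, hL]
    ring
  push Not at hD0
  have hG0 : G z₁ ≠ 0 := mul_ne_zero hz₁ (Complex.exp_ne_zero _)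
  obtain ⟨c, hc⟩ := exists_eq_const_mul hFd hGd (fun z ↦ by
    have := hD0 z
    rw [hF', hG']
    simp only [hD, hL] at this
    simp only [hF, hG]
    linear_combination (-Complex.exp (g (z + 1)) * Complex.exp (g (z + -1))) * this) hG0
  -- With `F = c G` the relation reads `(c - 1) G = k`: for `c = 1` it forces `k = 0`, otherwise it
  -- isolates `e^{g(z-1)}`.
  by_cases hc1 : c = 1
  · refine Or.inr ⟨Q, fun z ↦ ?_⟩
    have := hFG z
    rw [hc, hc1, one_mul, sub_self] at this
    exact (sub_eq_zero.1 this.symm).symm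
  · have hc1 : c - 1 ≠ 0 := sub_ne_zero.2 hc1
    refine Or.inl ⟨fun z ↦ (c - 1) * V.eval z, k, z₁, -1, by simp, V.differentiable.const_mul _,
      mul_ne_zero hc1 hz₁, (Tame.const g _).mul hgc (Tame.eval hgc V), tk, fun z ↦ ?_⟩
    rw [← hFG, hc]
    simp only [hG]
    ring

/-! ### Growth of `g` -/

lemma exists_norm_eval_le (P : ℂ[X]) : ∃ N : ℕ, ∀ z, ‖P.eval z‖ ≤ (N + 2 + ‖z‖) ^ N := by
  obtain ⟨N, hN⟩ := Tame.eval (g := fun _ ↦ 0) continuous_const P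
  refine ⟨N, fun z ↦ ?_⟩
  have h0 : maxMod (fun _ ↦ 0) (‖z‖ + N) = 0 :=
    le_antisymm (maxMod_le (by positivity) (by simp)) (maxMod_nonneg _ _)
  simpa [growthBase, h0] using hN z

lemma exists_le_norm_eval {S : ℂ[X]} (hS : S ≠ 0) :
    ∃ ρ δ : ℝ, 0 ≤ ρ ∧ 0 < δ ∧ ∀ z, ρ ≤ ‖z‖ → δ ≤ ‖S.eval z‖ := by
  rcases le_or_gt S.degree 0 with h | h
  · rw [eq_C_of_degree_le_zero h] at hS ⊢
    refine ⟨0, ‖S.coeff 0‖, le_rfl, norm_pos_iff.2 fun h ↦ hS (by rw [h, map_zero]), by simp⟩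
  · have ht := (S.tendsto_norm_atTop h tendsto_norm_cocompact_atTop).eventually_ge_atTop 1
    obtain ⟨r, hr⟩ := Metric.closedBall_compl_subset_of_mem_cocompact ht 0
    refine ⟨max 0 (r + 1), 1, le_max_left _ _, one_pos, fun z hz ↦ hr ?_⟩
    simpa using (lt_add_one r).trans_le ((le_max_right _ _).trans hz)

lemma posLog_pow_eq_mul_log {X : ℝ} (N : ℕ) (hX : 1 ≤ X) : log⁺ (X ^ N) = N * log X := by
  rw [posLog_pow, posLog_eq_log (by rwa [abs_of_nonneg (by linarith)])]

/-- Allowing every `N ≥ N₀` lets two tame functions share one `N`. -/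
lemma Tame.exists_characteristic_le {g f : ℂ → ℂ} (hg : Continuous g) (hf : Differentiable ℂ f)
    (h : Tame g f) : ∃ N₀ : ℕ, ∀ N, N₀ ≤ N → ∀ r, 0 ≤ r →
      characteristic f ⊤ r ≤ N * log (growthBase g N r) := by
  obtain ⟨N₀, h⟩ := h
  refine ⟨N₀, fun N hN r hr ↦ ?_⟩
  have hX := two_le_growthBase g N hr
  rw [← posLog_pow_eq_mul_log N (by linarith)]
  refine characteristic_top_le_posLog hf hr fun z hz ↦ ?_
  subst hz
  exact (Tame.of_le hg hN h z).trans (pow_le_pow_right₀ (by linarith) hN)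

/-- If a shift of `e^g` is a quotient of tame functions, then the maximum modulus of `g` satisfies
a growth recursion. -/
lemma exists_maxMod_recursion {g D H : ℂ → ℂ} (hg : Differentiable ℂ g) {z₀ c : ℂ} (hc : ‖c‖ = 1)
    (hD : Differentiable ℂ D) (h0 : D z₀ ≠ 0) (tD : Tame g D) (tH : Tame g H)
    (h : ∀ z, D z * Complex.exp (g (z + c)) = H z) :
    ∃ K s : ℝ, 1 ≤ K ∧ 0 < s ∧ ∀ R, 0 ≤ R → maxMod g R ≤
      K * (R + s) ^ 2 * (log (R + s) + log (1 + maxMod g (R + s)) + 1) := by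
  set f : ℂ → ℂ := fun z ↦ g (z + c) with hf
  have hfd : Differentiable ℂ f := hg.comp (differentiable_id.add_const c)
  have hHd : Differentiable ℂ H := by
    rw [← funext h]
    exact hD.mul hfd.cexp
  obtain ⟨K₀, hK₀, hK⟩ := exists_norm_le_characteristic_exp hfd
  obtain ⟨C₁, hC₁⟩ := characteristic_exp_le hD h0 hfd h
  obtain ⟨N₁, hN₁⟩ := tD.exists_characteristic_le hg.continuous hD
  obtain ⟨N₂, hN₂⟩ := tH.exists_characteristic_le hg.continuous hHd
  set N := N₁ + N₂
  have hN0 : (0 : ℝ) ≤ N := N.cast_nonneg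
  -- Evaluating at `R + 3` leaves room for the unit shift and the gap of 2; the remaining `N + 2`
  -- comes from the prefactor of `growthBase`.
  have hs : (0 : ℝ) < N + 5 := by linarith
  have hK1 : 1 ≤ 2 * N + |C₁| + 1 := by linarith [abs_nonneg C₁]
  refine ⟨K₀ * (2 * N + |C₁| + 1), N + 5, by nlinarith, hs, fun R hR ↦ maxMod_le hR
    fun z hz ↦ ?_⟩
  have e : g z = f (z - c) := by simp [f]
  have hz' : ‖z - c‖ ≤ R + 3 - 2 := by linarith [norm_sub_le z c]
  have h1 := hK (R + 3) (by linarith) (z - c) hz'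
  have h2 := hC₁ (R + 3) (by linarith)
  have h3 := hN₁ N (by omega) (R + 3) (by linarith)
  have h4 := hN₂ N (by omega) (R + 3) (by linarith)
  have hM := maxMod_nonneg g (R + (N + 5))
  have hM' := maxMod_nonneg g (R + 3 + N)
  have hlogX : log (growthBase g N (R + 3)) ≤
      log (R + (N + 5)) + log (1 + maxMod g (R + (N + 5))) := by
    rw [growthBase, log_mul (by linarith) (by linarith)]
    have := maxMod_mono hg.continuous (show 0 ≤ R + 3 + N by linarith)
      (show R + 3 + N ≤ R + (N + 5) by linarith)
    exact add_le_add (log_le_log (by linarith) (by linarith))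
      (log_le_log (by linarith) (by linarith))
  have hl : 0 ≤ log (R + (N + 5)) + log (1 + maxMod g (R + (N + 5))) :=
    add_nonneg (log_nonneg (by linarith)) (log_nonneg (by linarith))
  set Y := log (R + (N + 5)) + log (1 + maxMod g (R + (N + 5)))
  rw [e]
  calc ‖f (z - c)‖ ≤ _ := h1
    _ ≤ K₀ * (R + (N + 5)) ^ 2 * ((2 * N + |C₁| + 1) * (Y + 1)) := by
      have hT := characteristic_nonneg (f := fun z ↦ Complex.exp (f z)) (a := ⊤)
        (show 1 ≤ R + 3 by linarith)
      have hT' : characteristic (fun z ↦ Complex.exp (f z)) ⊤ (R + 3) + 1 ≤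
          (2 * N + |C₁| + 1) * (Y + 1) := by
        have := mul_le_mul_of_nonneg_left hlogX hN0
        have := le_abs_self C₁
        have := mul_nonneg (abs_nonneg C₁) hl
        nlinarith
      gcongr
      linarith
    _ = _ := by ring

section

variable {w g : ℂ → ℂ} {P : ℂ[X]}

/-- Here `e^g = w / P`, and the polynomial costs at most a linear term, absorbed by one more factor
`R`. -/
lemma exists_maxMod_le_characteristic (hg : Differentiable ℂ g) (hP : P ≠ 0)
    (h : ∀ z, w z = P.eval z * Complex.exp (g z)) :
    ∃ K : ℝ, 0 ≤ K ∧ ∀ᶠ R in atTop,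
      maxMod g (R - 2) ≤ K * R ^ 3 * (characteristic w ⊤ R + K) := by
  obtain ⟨z₀, hz₀⟩ : ∃ z, P.eval z ≠ 0 := by
    by_contra! hne
    exact hP (Polynomial.funext fun z ↦ by simpa using hne z)
  obtain ⟨K₀, hK₀, hK⟩ := exists_norm_le_characteristic_exp hg
  obtain ⟨C₁, hC₁⟩ := characteristic_exp_le P.differentiable hz₀ hg fun z ↦ (h z).symm
  obtain ⟨N, hN⟩ := exists_norm_eval_le P
  have hN0 : (0 : ℝ) ≤ N := N.cast_nonneg
  set K₂ : ℝ := N * (N + 2) + |C₁| + 1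
  have hK₂ : 0 ≤ K₂ := by positivity
  refine ⟨K₀ + K₂, by linarith, ?_⟩
  filter_upwards [eventually_ge_atTop 2] with R hR
  refine maxMod_le (by linarith) fun z hz ↦ (hK R hR z hz).trans ?_
  have h1 := hC₁ R (by linarith)
  have h2 : characteristic (fun z ↦ P.eval z) ⊤ R ≤ N * (N + 1 + R) := by
    refine (characteristic_top_le_posLog P.differentiable (by linarith)
      (b := (N + 2 + R) ^ N) fun z hz ↦ by simpa [hz] using hN z).trans ?_
    rw [posLog_pow_eq_mul_log N (by linarith)]
    gcongr
    linarith [log_le_sub_one_of_pos (show 0 < N + 2 + R by linarith)]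
  have hT := characteristic_nonneg (f := w) (a := ⊤) (show 1 ≤ R by linarith)
  have hT' := characteristic_nonneg (f := fun z ↦ Complex.exp (g z)) (a := ⊤)
    (show 1 ≤ R by linarith)
  have h3 : characteristic (fun z ↦ Complex.exp (g z)) ⊤ R + 1 ≤
      R * (characteristic w ⊤ R + K₂) := by
    have e1 : |C₁| + 1 ≤ R * (|C₁| + 1) := by nlinarith [abs_nonneg C₁]
    have e2 : (N : ℝ) * (N + 1 + R) ≤ R * (N * (N + 2)) := by
      nlinarith [mul_nonneg hN0 hN0, mul_nonneg hN0 (show 0 ≤ R - 1 by linarith),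
        mul_nonneg (mul_nonneg hN0 hN0) (show 0 ≤ R - 1 by linarith)]
    have e3 : characteristic w ⊤ R ≤ R * characteristic w ⊤ R := by nlinarith
    have := le_abs_self C₁
    simp only [K₂]
    nlinarith
  calc K₀ * R ^ 2 * (characteristic (fun z ↦ Complex.exp (g z)) ⊤ R + 1)
      ≤ (K₀ + K₂) * R ^ 2 * (R * (characteristic w ⊤ R + (K₀ + K₂))) := by
        have e4 : characteristic w ⊤ R + K₂ ≤ characteristic w ⊤ R + (K₀ + K₂) := by linarith
        have e5 := h3.trans (mul_le_mul_of_nonneg_left e4 (by linarith))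
        gcongr
        linarith
    _ = _ := by ring

/-- Since `log⁺ |e^g| ≤ |g|`, the characteristic of `w` is at most `M(r)` plus a linear term from
`P`; starting from the power `k + 2` pays for that term. -/
lemma frequently_pow_le_maxMod (hw : Differentiable ℂ w) (hg : Differentiable ℂ g)
    (h : ∀ z, w z = P.eval z * Complex.exp (g z)) (hinf : HasInfiniteOrder w) (k : ℕ) :
    ∃ᶠ r in atTop, r ^ k ≤ maxMod g r := by
  obtain ⟨N, hN⟩ := exists_norm_eval_le P
  have hN0 : (0 : ℝ) ≤ N := N.cast_nonneg
  refine ((hinf.frequently_pow_lt (k + 2)).and_eventually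
    (eventually_ge_atTop ((N : ℝ) * (N + 2) + 1))).mono ?_
  rintro r ⟨hr, hrN⟩
  have hr1 : 1 ≤ r := by nlinarith
  have h1 : characteristic w ⊤ r ≤ N * (N + 1 + r) + maxMod g r := by
    refine (characteristic_top_le_posLog hw (by linarith)
      (b := (N + 2 + r) ^ N * exp (maxMod g r)) fun z hz ↦ ?_).trans ?_
    · rw [h, norm_mul, Complex.norm_exp]
      gcongr
      · simpa [hz] using hN z
      · exact (Complex.re_le_norm _).trans (norm_le_maxMod hg.continuous hz.le)
    · refine posLog_mul.trans ?_
      rw [posLog_pow_eq_mul_log N (by linarith)]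
      have e1 : log⁺ (exp (maxMod g r)) = maxMod g r := by
        rw [posLog_eq_log, log_exp]
        rw [abs_of_pos (exp_pos _)]
        exact one_le_exp (maxMod_nonneg _ _)
      rw [e1]
      gcongr
      linarith [log_le_sub_one_of_pos (show 0 < N + 2 + r by linarith)]
  have h2 : 1 + N * (N + 1 + r) ≤ r ^ 2 := by
    nlinarith [mul_nonneg hN0 (show 0 ≤ r - 1 by linarith),
      mul_nonneg (mul_nonneg hN0 hN0) (show 0 ≤ r - 1 by linarith)]
  have h3 : 1 ≤ r ^ k := one_le_pow₀ hr1
  have h4 : 0 ≤ N * (N + 1 + r) := by positivity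
  rw [pow_add] at hr
  nlinarith [mul_le_mul_of_nonneg_left h2 (show 0 ≤ r ^ k by linarith),
    mul_nonneg (show 0 ≤ r ^ k - 1 by linarith) h4]

end

/-- An entire function with rational derivative has polynomial growth. -/
lemma not_frequently_pow_le_maxMod {g : ℂ → ℂ} (hg : Differentiable ℂ g) {S Q : ℂ[X]}
    (hS : S ≠ 0) (h : ∀ z, S.eval z * deriv g z = Q.eval z) :
    ∃ k : ℕ, ¬ ∃ᶠ r in atTop, r ^ k ≤ maxMod g r := by
  obtain ⟨ρ, δ, hρ, hδ, hSδ⟩ := exists_le_norm_eval hS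
  obtain ⟨N, hN⟩ := exists_norm_eval_le Q
  have hN0 : (0 : ℝ) ≤ N := N.cast_nonneg
  set m := maxMod (deriv g) ρ
  have hm : 0 ≤ m := maxMod_nonneg _ _
  -- Exponent `2 N` bounds `Q`, one more bounds `1 / δ`, one comes from integrating `g'` along a
  -- radius, and two are slack.
  refine ⟨2 * N + 4, ?_⟩
  rw [not_frequently]
  filter_upwards [eventually_ge_atTop (N + 4 : ℝ), eventually_ge_atTop (1 / δ),
    eventually_ge_atTop m, eventually_ge_atTop ‖g 0‖] with r h1 h2 h3 h4
  have hr0 : 0 ≤ r := by linarith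
  have hder (z : ℂ) (hz : z ∈ closedBall (0 : ℂ) r) :
      ‖deriv g z‖ ≤ r ^ (2 * N + 1) + r := by
    have hz : ‖z‖ ≤ r := by simpa using hz
    rcases le_total ρ ‖z‖ with hle | hle
    · have e1 : δ * ‖deriv g z‖ ≤ (N + 2 + r) ^ N := by
        calc δ * ‖deriv g z‖ ≤ ‖S.eval z‖ * ‖deriv g z‖ := by gcongr; exact hSδ z hle
          _ = ‖Q.eval z‖ := by rw [← norm_mul, h]
          _ ≤ (N + 2 + ‖z‖) ^ N := hN z
          _ ≤ _ := by gcongr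
      have e2 : (N + 2 + r) ^ N ≤ r ^ (2 * N) := by
        rw [pow_mul]
        gcongr
        nlinarith
      calc ‖deriv g z‖ = 1 / δ * (δ * ‖deriv g z‖) := by field_simp
        _ ≤ r * r ^ (2 * N) := by
          gcongr
          exact e1.trans e2
        _ = r ^ (2 * N + 1) := by ring
        _ ≤ _ := by linarith
    · have : ‖deriv g z‖ ≤ m := norm_le_maxMod hg.deriv.continuous hle
      have : 0 ≤ r ^ (2 * N + 1) := by positivity
      linarith
  have hbound : maxMod g r ≤ r + (r ^ (2 * N + 1) + r) * r := by
    refine maxMod_le hr0 fun z hz ↦ ?_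
    have := (convex_closedBall (0 : ℂ) r).norm_image_sub_le_of_norm_deriv_le
      (fun x _ ↦ hg x) hder (x := 0) (y := z) (by simpa using hr0) (by simpa using hz)
    rw [sub_zero] at this
    have e1 : ‖g z‖ ≤ ‖g z - g 0‖ + ‖g 0‖ := norm_le_norm_sub_add _ _
    have e2 : (r ^ (2 * N + 1) + r) * ‖z‖ ≤ (r ^ (2 * N + 1) + r) * r := by gcongr
    linarith
  rw [not_le]
  refine hbound.trans_lt ?_
  have hr4 : 4 ≤ r := by linarith
  have e1 : 1 ≤ r ^ (2 * N) := one_le_pow₀ (by linarith)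
  have e2 : r ^ (2 * N + 4) = r ^ (2 * N) * r ^ 4 := pow_add _ _ _
  have e3 : r ^ (2 * N + 1) = r ^ (2 * N) * r := pow_succ _ _
  rw [e2, e3]
  have e4 : r + (1 * r + r) * r ≤ 3 * r ^ 2 := by nlinarith
  have e5 : 3 * r ^ 2 < r ^ 4 := by nlinarith [sq_nonneg r]
  calc r + (r ^ (2 * N) * r + r) * r ≤ r ^ (2 * N) * (3 * r ^ 2) := by nlinarith [sq_nonneg r]
    _ < _ := by gcongr

end DelayDifferential

theorem theorem1p4 (a a₀ : RatFunc ℂ) (ha : a ≠ 0) :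
    ¬ ∃ w : ℂ → ℂ,
      DelayDifferential.IsEntireSolution a a₀ w ∧
      DelayDifferential.HasInfiniteOrder w ∧
      DelayDifferential.HasFiniteIteratedOrder w := by
  open DelayDifferential in
  rintro ⟨w, hsol, hinf, hfin⟩
  obtain ⟨z₀, hz₀⟩ := hsol.ne_zero
  obtain ⟨A, B, C, hA, hB, hABC⟩ := hsol.exists_polynomial_identity ha
  obtain ⟨P, g, hP, hg, hwg⟩ := exists_eval_mul_exp_of_identity hsol.entire hz₀ hB hABC
  have hfreq := frequently_pow_le_maxMod hsol.entire hg hwg hinf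
  obtain rfl : w = fun z ↦ P.eval z * Complex.exp (g z) := funext hwg
  rcases exists_tame_or_deriv_eq hg hA hP hABC with
    ⟨D, H, z₁, c, hc, hD, hD0, tD, tH, hDH⟩ | ⟨Q, hQ⟩
  · obtain ⟨K, s, hK, hs, hrec⟩ := exists_maxMod_recursion hg hc hD hD0 tD tH hDH
    obtain ⟨R₀, hR₀, hlower⟩ := exists_exp_iterate_le
      (fun _ _ ↦ maxMod_mono hg.continuous) hK hs.le hrec (hfreq 6)
    obtain ⟨K', hK', hM⟩ := exists_maxMod_le_characteristic hg hP hwg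
    obtain ⟨i, C', hi, hT⟩ := hfin.exists_le
    exact false_of_exp_iterate_le hi hs hK' (by linarith) hlower hM hT
      ValueDistribution.characteristic_eventually_nonneg
  · obtain ⟨k, hk⟩ := not_frequently_pow_le_maxMod hg (mul_ne_zero hB hP) hQ
    exact hk (hfreq k)
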